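/- An access point serves $N$ clients over unreliable channels; time is slotted and a frame is one slot ($\tau=1$). At the beginning of each slot $t=0,1,2,\dots$ a fresh packet is available for every client, and the access point transmits the packet of exactly one client, chosen on the basis of the information $\mathcal F_t$ available at the beginning of slot $t$. Given $\mathcal F_t$, a transmission to client $j$ succeeds with probability $p_j$, where $0<p_j\le 1$; packets that are not delivered in their slot are dropped. Let $q_j>0$ be the required timely throughput of client $j$, and assume that $\sum_{j=1}^N q_j/p_j=1$. Let $$d_j(t)=t\,q_j-\#\{\text{packets of client } j \text{ delivered in the slots } 0,\dots,t-1\}$$ be the debt of client $j$, and put $$\phi(t)=\sqrt{2t\log\log t},\qquad c_j=\frac{q_j(1-p_j)}{p_j^2}.$$ Suppose that the access point uses the maximum weighted debt first (MWDF) policy: in every slot $t$ it serves a client $j$ that maximizes $d_j(t)/p_j$, ties being broken arbitrarily (on the basis of $\mathcal F_t$). Then, almost surely, for every $j=1,\dots,N$, $$\limsup_{t\to\infty}\frac{d_j(t)}{\phi(t)}\;\le\;p_j\,\frac{\sum_{k=1}^N\sqrt{c_k}}{N}.$$ -/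

import Mathlib

open MeasureTheory ProbabilityTheory Filter

/-- The normalisation `φ(t) = √(2 t log log t)` of the law of the iterated logarithm. -/
noncomputable def phi (t : ℕ) : ℝ :=
  Real.sqrt (2 * (t : ℝ) * Real.log (Real.log (t : ℝ)))

/-- The constant `c = q (1 - p) / p ^ 2` of a client with channel reliability `p` and required
timely throughput `q`. -/
noncomputable def lilConst (p q : ℝ) : ℝ := q * (1 - p) / p ^ 2

/-- An access point with `N` clients and frames of one slot. Slot `t` is frame `t`; every client
has a fresh packet at its beginning, and one packet is transmitted in it.
`served t ω` is the client attempted in slot `t`, and `success t` is the event that this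
transmission succeeds. The σ-algebra `ℱ t` is the information available at the beginning of
slot `t`: the choice of client may use that information only, and, given it, the transmission
succeeds with the reliability of the channel of the chosen client. -/
structure IsSlottedNetwork {Ω : Type*} [mΩ : MeasurableSpace Ω] (μ : Measure Ω)
    (ℱ : Filtration ℕ mΩ) {N : ℕ} (p : Fin N → ℝ)
    (served : ℕ → Ω → Fin N) (success : ℕ → Set Ω) : Prop where
  served_measurable : ∀ t, Measurable[ℱ t] (served t)
  success_measurable : ∀ t, MeasurableSet[ℱ (t + 1)] (success t)
  success_prob : ∀ t,
    μ[(success t).indicator (fun _ => (1 : ℝ)) | ℱ t] =ᵐ[μ] fun ω => p (served t ω)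

/-- The event that a packet of client `j` is delivered in slot `t`. -/
def deliveredTo {Ω : Type*} {N : ℕ} (served : ℕ → Ω → Fin N) (success : ℕ → Set Ω)
    (j : Fin N) (t : ℕ) : Set Ω :=
  {ω | served t ω = j ∧ ω ∈ success t}

/-- The debt of client `j` at the beginning of frame `t`: `t q_j` minus the number of its packets
delivered in the frames `0, …, t - 1`. -/
noncomputable def debt {Ω : Type*} {N : ℕ} (q : Fin N → ℝ) (served : ℕ → Ω → Fin N)
    (success : ℕ → Set Ω) (j : Fin N) (t : ℕ) (ω : Ω) : ℝ :=
  (t : ℝ) * q j -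
    ∑ l ∈ Finset.range t, (deliveredTo served success j l).indicator (fun _ => (1 : ℝ)) ω

/-- The maximum weighted debt first policy: in every slot the client served has the largest value
of `d_j(t) / p_j`. Ties may be broken in any way. -/
def IsMWDF {Ω : Type*} {N : ℕ} (p q : Fin N → ℝ) (served : ℕ → Ω → Fin N)
    (success : ℕ → Set Ω) : Prop :=
  ∀ (t : ℕ) (ω : Ω) (k : Fin N),
    debt q served success k t ω / p k ≤
      debt q served success (served t ω) t ω / p (served t ω)

/-!
The sum of the weighted debts `d_k / p_k` is a martingale: it grows by `∑ q_k / p_k = 1` in every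
slot, and serving any client reduces it by `1` on average. Its conditional variance in a slot where
client `k` is served is `(1 - p_k) / p_k`.
Under MWDF the client served has the largest weighted debt, so serving it pushes the weighted debts
towards their common average. The sum of the exponentials of a small multiple of the excesses over
this average therefore has a negative drift outside a bounded set and bounded expectation, and by
Borel–Cantelli the excesses are `O(log t)`: on the scale `φ` every `d_k / p_k` equals the average.

Since all debts are then `o(t)`, client `k` is served at rate `q_k / p_k`, which makes `∑ c_k` the
variance rate of the martingale. The upper half of the law of the iterated logarithm, obtained from
Ville's inequality for `exp (r S - (1 + δ) / 2 * r² ⟨S⟩)` on geometric time blocks, bounds the sum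
of the weighted debts by `√(∑ c_k) φ` asymptotically, and `√(∑ c_k) ≤ ∑ √c_k`.
-/

open Asymptotics Topology

section RealAnalysis

theorem exp_le_one_add_add_mul_sq {x δ : ℝ} (hx : |x| ≤ δ) (hδ : δ ≤ 1) :
    Real.exp x ≤ 1 + x + (1 + δ) / 2 * x ^ 2 := by
  have taylor := le_of_abs_le (Real.exp_bound (hx.trans hδ) (n := 3) (by norm_num))
  norm_num [Finset.sum_range_succ, Nat.factorial] at taylor
  have cube_le : |x| ^ 3 ≤ δ * x ^ 2 := by
    rw [pow_succ', sq_abs]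
    exact mul_le_mul_of_nonneg_right hx (sq_nonneg x)
  have cube_nonneg : 0 ≤ |x| ^ 3 := by positivity
  linarith

theorem sqrt_sum_le_sum_sqrt {ι : Type*} {s : Finset ι} {f : ι → ℝ} (hf : ∀ i ∈ s, 0 ≤ f i) :
    √(∑ i ∈ s, f i) ≤ ∑ i ∈ s, √(f i) := by
  refine Real.sqrt_le_iff.2 ⟨Finset.sum_nonneg fun i _ => Real.sqrt_nonneg _, ?_⟩
  calc ∑ i ∈ s, f i = ∑ i ∈ s, √(f i) ^ 2 :=
        Finset.sum_congr rfl fun i hi => (Real.sq_sqrt (hf i hi)).symm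
    _ ≤ (∑ i ∈ s, √(f i)) ^ 2 := Finset.sum_sq_le_sq_sum_of_nonneg fun i _ => Real.sqrt_nonneg _

theorem abs_le_card_mul_of_sum_eq_zero {ι : Type*} [Fintype ι] {x : ι → ℝ} {c : ℝ}
    (hsum : ∑ i, x i = 0) (hx : ∀ i, x i ≤ c) (j : ι) : |x j| ≤ Fintype.card ι * c := by
  have hsplit : ∑ i, (c - x i) = Fintype.card ι * c := by
    simp [Finset.sum_sub_distrib, hsum]
  have hj : c - x j ≤ Fintype.card ι * c := hsplit ▸
    Finset.single_le_sum (f := fun i => c - x i) (fun i _ => sub_nonneg.2 (hx i))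
      (Finset.mem_univ j)
  have hcard : (1 : ℝ) ≤ Fintype.card ι := by exact_mod_cast Fintype.card_pos_iff.2 ⟨j⟩
  have hc : 0 ≤ Fintype.card ι * c := hsplit ▸ Finset.sum_nonneg fun i _ => sub_nonneg.2 (hx i)
  have hc' : 0 ≤ c := nonneg_of_mul_nonneg_right hc (by linarith)
  exact abs_le.2 ⟨by linarith, (hx j).trans (le_mul_of_one_le_left hc' hcard)⟩

theorem abs_le_mul_of_abs_sub_le {u : ℕ → ℝ} {K : ℝ} (h0 : u 0 = 0)
    (hu : ∀ t, |u (t + 1) - u t| ≤ K) (t : ℕ) : |u t| ≤ t * K := by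
  have h := dist_le_range_sum_of_dist_le (f := u) (d := fun _ => K) t fun {k} _ => by
    rw [dist_comm, Real.dist_eq]
    exact hu k
  simpa [h0, Real.dist_eq] using h

theorem limsup_div_le_of_forall_gt {α : Type*} {l : Filter α} {f g : α → ℝ} {c : ℝ}
    (hg : ∀ᶠ t in l, 0 < g t) (h : ∀ y > c, ∀ᶠ t in l, f t ≤ y * g t) :
    limsup (fun t => ((f t / g t : ℝ) : EReal)) l ≤ (c : EReal) := by
  refine EReal.le_of_forall_lt_iff_le.1 fun y hy => limsup_le_of_le (by isBoundedDefault) ?_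
  filter_upwards [hg, h y (EReal.coe_lt_coe_iff.1 hy)] with t hpos hle
  exact EReal.coe_le_coe_iff.2 ((div_le_iff₀ hpos).2 hle)

end RealAnalysis

section Phi

theorem tendsto_log_log_natCast_atTop :
    Tendsto (fun t : ℕ => Real.log (Real.log t)) atTop atTop :=
  Real.tendsto_log_atTop.comp (Real.tendsto_log_atTop.comp tendsto_natCast_atTop_atTop)

theorem phi_nonneg (t : ℕ) : 0 ≤ phi t := Real.sqrt_nonneg _

theorem eventually_sqrt_le_phi : ∀ᶠ t : ℕ in atTop, √(t : ℝ) ≤ phi t := by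
  filter_upwards [tendsto_log_log_natCast_atTop.eventually_ge_atTop 1] with t ht
  refine Real.sqrt_le_sqrt ?_
  have : (0 : ℝ) ≤ t := Nat.cast_nonneg t
  nlinarith

theorem eventually_phi_pos : ∀ᶠ t : ℕ in atTop, 0 < phi t := by
  filter_upwards [eventually_sqrt_le_phi, eventually_gt_atTop 0] with t hle ht
  exact (Real.sqrt_pos.2 (by exact_mod_cast ht)).trans_le hle

theorem log_isLittleO_phi : (fun t : ℕ => Real.log t) =o[atTop] phi := by
  have hlog : (fun t : ℕ => Real.log t) =o[atTop] fun t : ℕ => √(t : ℝ) := by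
    simpa only [Real.sqrt_eq_rpow, Function.comp_def] using
      (isLittleO_log_rpow_atTop (r := 1 / 2) (by norm_num)).comp_tendsto
        (tendsto_natCast_atTop_atTop (R := ℝ))
  refine hlog.trans_isBigO (IsBigO.of_bound' ?_)
  filter_upwards [eventually_sqrt_le_phi] with t ht
  simpa only [Real.norm_of_nonneg (Real.sqrt_nonneg _), Real.norm_of_nonneg (phi_nonneg t)] using ht

theorem phi_isLittleO_natCast : phi =o[atTop] fun t : ℕ => (t : ℝ) := by
  refine isLittleO_iff.2 fun ε hε => ?_
  have hlog := (Real.isLittleO_log_id_atTop.comp_tendsto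
    (tendsto_natCast_atTop_atTop (R := ℝ))).bound (by positivity : 0 < ε ^ 2 / 2)
  filter_upwards [hlog] with t ht
  simp only [Function.comp_apply, id, Real.norm_natCast,
    Real.norm_of_nonneg (Real.log_natCast_nonneg t)] at ht
  rw [Real.norm_of_nonneg (phi_nonneg t), Real.norm_natCast]
  refine Real.sqrt_le_iff.2 ⟨by positivity, ?_⟩
  calc 2 * (t : ℝ) * Real.log (Real.log t) ≤ 2 * t * (ε ^ 2 / 2 * t) := by
        gcongr
        exact (Real.log_le_self (Real.log_natCast_nonneg t)).trans ht
    _ = (ε * t) ^ 2 := by ring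

end Phi

section Blocks

/-- The tilt used on the time block `[(1 + δ) ^ k, (1 + δ) ^ (k + 1))` in the law of the iterated
logarithm for a process of unit variance per time step. It minimises `log k / m + m t / 2` over `m`
at the left end point `t` of the block; this is the bound on the process at time `t` when the
exponential supermartingale of tilt `m` stays below `k`. -/
noncomputable def blockTilt (δ : ℝ) (k : ℕ) : ℝ := √(2 * Real.log k / (1 + δ) ^ k)

variable {δ : ℝ}

theorem sq_blockTilt_mul_pow (hδ : 0 < δ) (k : ℕ) :
    blockTilt δ k ^ 2 * (1 + δ) ^ k = 2 * Real.log k := by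
  have := Real.log_natCast_nonneg k
  rw [blockTilt, Real.sq_sqrt (by positivity), div_mul_cancel₀ _ (by positivity)]

theorem tendsto_blockTilt_zero (hδ : 0 < δ) : Tendsto (blockTilt δ) atTop (𝓝 0) := by
  have hpow := tendsto_pow_const_div_const_pow_of_one_lt 1 (by linarith : 1 < 1 + δ)
  have hlog : Tendsto (fun k : ℕ => 2 * Real.log k / (1 + δ) ^ k) atTop (𝓝 0) := by
    refine squeeze_zero (fun k => ?_) (fun k => ?_) (by simpa using hpow.const_mul 2)
    · have := Real.log_natCast_nonneg k
      positivity
    · rw [← mul_div_assoc]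
      gcongr
      simpa only [pow_one] using Real.log_le_self (Nat.cast_nonneg k)
  exact (Real.continuous_sqrt.tendsto' 0 0 Real.sqrt_zero).comp hlog

theorem eventually_log_le_log_log_of_pow_le (hδ : 0 < δ) :
    ∀ᶠ k : ℕ in atTop, ∀ t : ℕ, (1 + δ) ^ k ≤ (t : ℝ) →
      Real.log k ≤ (1 + δ) * Real.log (Real.log t) := by
  have hlogδ : 0 < Real.log (1 + δ) := Real.log_pos (by linarith)
  have hlarge : ∀ᶠ k : ℕ in atTop, -(1 + δ) * Real.log (Real.log (1 + δ)) / δ ≤ Real.log k :=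
    (Real.tendsto_log_atTop.comp tendsto_natCast_atTop_atTop).eventually_ge_atTop _
  filter_upwards [hlarge, eventually_gt_atTop 0] with k hk hk0 t ht
  have hk0 : (0 : ℝ) < k := by exact_mod_cast hk0
  have hloglog : Real.log k + Real.log (Real.log (1 + δ)) ≤ Real.log (Real.log t) := by
    rw [← Real.log_mul hk0.ne' hlogδ.ne', ← Real.log_pow]
    exact Real.log_le_log (by rw [Real.log_pow]; positivity) (Real.log_le_log (by positivity) ht)
  rw [div_le_iff₀ hδ] at hk
  nlinarith

theorem eventually_blockTilt_mul_pow_le_phi (hδ : 0 < δ) :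
    ∀ᶠ k : ℕ in atTop, ∀ t : ℕ, (1 + δ) ^ k ≤ (t : ℝ) →
      blockTilt δ k * (1 + δ) ^ k ≤ (1 + δ) * phi t := by
  filter_upwards [eventually_log_le_log_log_of_pow_le hδ] with k hk t ht
  have hlog := hk t ht
  have hlogk := Real.log_natCast_nonneg k
  have hloglog : 0 ≤ Real.log (Real.log t) := nonneg_of_mul_nonneg_right (hlogk.trans hlog)
    (by positivity)
  refine le_of_sq_le_sq ?_ (mul_nonneg (by positivity) (phi_nonneg t))
  rw [mul_pow (1 + δ), phi, Real.sq_sqrt (by positivity)]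
  calc (blockTilt δ k * (1 + δ) ^ k) ^ 2
      = 2 * Real.log k * (1 + δ) ^ k := by rw [← sq_blockTilt_mul_pow hδ]; ring
    _ ≤ 2 * ((1 + δ) * Real.log (Real.log t)) * t := by gcongr
    _ = (1 + δ) * (2 * t * Real.log (Real.log t)) := by ring
    _ ≤ (1 + δ) ^ 2 * (2 * t * Real.log (Real.log t)) := by
      gcongr
      exact le_self_pow₀ (by linarith) two_ne_zero

theorem le_blockTilt_mul_pow {s S V t : ℝ} {k : ℕ} (hs : 0 < s) (hδ : 0 < δ) (hk : 1 < k)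
    (ht : t ≤ (1 + δ) ^ (k + 1)) (hV : V ≤ s ^ 2 * t)
    (hS : blockTilt δ k / s * S - (1 + δ) / 2 * ((blockTilt δ k / s) ^ 2 * V) ≤
      (1 + δ) * Real.log k) :
    S ≤ (1 + δ) ^ 2 * s * (blockTilt δ k * (1 + δ) ^ k) := by
  set m := blockTilt δ k
  have hm : 0 < m := by
    have := Real.log_pos (by exact_mod_cast hk : (1 : ℝ) < k)
    exact Real.sqrt_pos.2 (by positivity)
  have hvar : (m / s) ^ 2 * V ≤ m ^ 2 * t :=
    calc (m / s) ^ 2 * V ≤ (m / s) ^ 2 * (s ^ 2 * t) := by gcongr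
      _ = m ^ 2 * t := by field_simp
  have htime : t + (1 + δ) ^ k ≤ 2 * (1 + δ) * (1 + δ) ^ k := by
    have : 0 < δ * (1 + δ) ^ k := by positivity
    rw [pow_succ] at ht
    linarith
  refine le_of_mul_le_mul_left ?_ (div_pos hm hs)
  calc m / s * S ≤ (1 + δ) / 2 * ((m / s) ^ 2 * V) + (1 + δ) * Real.log k := by linarith
    _ ≤ (1 + δ) / 2 * (m ^ 2 * t) + (1 + δ) * Real.log k := by gcongr
    _ = (1 + δ) / 2 * (m ^ 2 * (t + (1 + δ) ^ k)) := by
      linear_combination -(1 + δ) / 2 * sq_blockTilt_mul_pow hδ k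
    _ ≤ (1 + δ) / 2 * (m ^ 2 * (2 * (1 + δ) * (1 + δ) ^ k)) := by gcongr
    _ = m / s * ((1 + δ) ^ 2 * s * (m * (1 + δ) ^ k)) := by field_simp

theorem eventually_le_phi_of_blockTilt {S V : ℕ → ℝ} {s : ℝ} (hs : 0 < s) (hδ : 0 < δ)
    (hV : ∀ᶠ t : ℕ in atTop, V t ≤ s ^ 2 * t)
    (hS : ∀ᶠ k : ℕ in atTop, ∀ t,
      blockTilt δ k / s * S t - (1 + δ) / 2 * ((blockTilt δ k / s) ^ 2 * V t) ≤
        (1 + δ) * Real.log k) :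
    ∀ᶠ t : ℕ in atTop, S t ≤ (1 + δ) ^ 3 * s * phi t := by
  have hδ1 : 1 < 1 + δ := by linarith
  obtain ⟨K, hK⟩ := eventually_atTop.1
    (hS.and ((eventually_blockTilt_mul_pow_le_phi hδ).and (eventually_gt_atTop 1)))
  have hlate : ∀ᶠ t : ℕ in atTop, (1 + δ) ^ K ≤ (t : ℝ) :=
    tendsto_natCast_atTop_atTop.eventually_ge_atTop _
  filter_upwards [hV, hlate] with t hVt htK
  obtain ⟨k, hkt, htk⟩ := exists_nat_pow_near ((one_le_pow₀ hδ1.le).trans htK) hδ1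
  have hKk : K ≤ k := Nat.lt_succ_iff.1 ((pow_lt_pow_iff_right₀ hδ1).1 (htK.trans_lt htk))
  obtain ⟨htilt, hphi, hk⟩ := hK k hKk
  calc S t ≤ (1 + δ) ^ 2 * s * (blockTilt δ k * (1 + δ) ^ k) :=
        le_blockTilt_mul_pow hs hδ hk htk.le hVt (htilt t)
    _ ≤ (1 + δ) ^ 2 * s * ((1 + δ) * phi t) :=
      mul_le_mul_of_nonneg_left (hphi t hkt) (by positivity)
    _ = (1 + δ) ^ 3 * s * phi t := by ring

end Blocks

section Supermartingale

variable {Ω : Type*} {m m0 : MeasurableSpace Ω} {μ : Measure Ω} {ℱ : Filtration ℕ m0}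

theorem ae_eventually_notMem_of_summable {E : ℕ → Set Ω} {u : ℕ → ℝ} (hu : Summable u)
    (hE : ∀ᶠ k in atTop, μ (E k) ≤ ENNReal.ofReal (u k)) :
    ∀ᵐ ω ∂μ, ∀ᶠ k in atTop, ω ∉ E k := by
  obtain ⟨K, hK⟩ := eventually_atTop.1 hE
  have hsum : ∑' k, μ (E (k + K)) ≠ ⊤ :=
    ne_top_of_le_ne_top ((summable_nat_add_iff K).2 hu).tsum_ofReal_ne_top
      (ENNReal.tsum_le_tsum fun k => hK (k + K) (Nat.le_add_left K k))
  filter_upwards [ae_eventually_notMem hsum] with ω hω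
  rwa [← map_add_atTop_eq_nat K, eventually_map]

theorem measure_exists_ge_le_of_supermartingale [IsFiniteMeasure μ] {f : ℕ → Ω → ℝ}
    (hf : Supermartingale f ℱ μ) (hnonneg : 0 ≤ f) {a : ℝ} (ha : 0 < a) :
    μ {ω | ∃ t, a ≤ f t ω} ≤ ENNReal.ofReal (μ[f 0] / a) := by
  have hbefore (n : ℕ) : μ {ω | ∃ t ≤ n, a ≤ f t ω} ≤ ENNReal.ofReal (μ[f 0] / a) := by
    let τ : Ω → ℕ∞ := fun ω => (hittingBtwn f (Set.Ici a) 0 n ω : ℕ)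
    have hτ : IsStoppingTime ℱ τ :=
      hf.stronglyAdapted.adapted.isStoppingTime_hittingBtwn measurableSet_Ici
    have hτn (ω : Ω) : τ ω ≤ n := by
      exact Nat.cast_le.2 <| hittingBtwn_le (u := f) (s := Set.Ici a) (n := 0) (m := n) ω
    have hint : Integrable (stoppedValue f τ) μ := integrable_stoppedValue ℕ hτ hf.integrable hτn
    have hstopped : μ[stoppedValue f τ] ≤ μ[f 0] := by
      have h := hf.neg.expected_stoppedValue_mono (isStoppingTime_const ℱ 0) hτ
        (fun _ => zero_le) hτn
      rw [stoppedValue_const] at h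
      have hneg : stoppedValue (-f) τ = -stoppedValue f τ := rfl
      rw [hneg, integral_neg', Pi.neg_apply, integral_neg'] at h
      exact neg_le_neg_iff.1 h
    have hsub : {ω | ∃ t ≤ n, a ≤ f t ω} ⊆ {ω | a ≤ stoppedValue f τ ω} := fun ω ⟨t, htn, hat⟩ =>
      stoppedValue_hittingBtwn_mem ⟨t, ⟨Nat.zero_le t, htn⟩, hat⟩
    refine (measure_mono hsub).trans ?_
    rw [← ofReal_measureReal]
    refine ENNReal.ofReal_le_ofReal ((le_div_iff₀' ha).2 (le_trans ?_ hstopped))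
    exact mul_meas_ge_le_integral_of_nonneg (.of_forall fun ω => hnonneg _ ω) hint a
  have hunion : {ω | ∃ t, a ≤ f t ω} = ⋃ n, {ω | ∃ t ≤ n, a ≤ f t ω} := by
    ext ω
    simp only [Set.mem_ofPred_eq, Set.mem_iUnion]
    exact ⟨fun ⟨t, hat⟩ => ⟨t, t, le_rfl, hat⟩, fun ⟨_, t, _, hat⟩ => ⟨t, hat⟩⟩
  have hmono : Monotone fun n => {ω | ∃ t ≤ n, a ≤ f t ω} := fun _ _ hmn _ ⟨t, htm, hat⟩ =>
    ⟨t, htm.trans hmn, hat⟩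
  rw [hunion, hmono.measure_iUnion]
  exact iSup_le hbefore

theorem integral_le_of_condExp_drift_le [IsProbabilityMeasure μ] {Φ : ℕ → Ω → ℝ} {κ b : ℝ}
    (hκ : κ ≤ 1) (hint : ∀ t, Integrable (Φ t) μ) (h0 : μ[Φ 0] ≤ b)
    (hdrift : ∀ t, μ[Φ (t + 1) | ℱ t] ≤ᵐ[μ] fun ω => (1 - κ) * Φ t ω + κ * b) (t : ℕ) :
    μ[Φ t] ≤ b := by
  induction t with
  | zero => exact h0
  | succ t ih =>
    calc μ[Φ (t + 1)] = ∫ ω, (μ[Φ (t + 1) | ℱ t]) ω ∂μ := (integral_condExp (ℱ.le t)).symm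
      _ ≤ ∫ ω, ((1 - κ) * Φ t ω + κ * b) ∂μ := integral_mono_ae integrable_condExp
          (((hint t).const_mul _).add (integrable_const _)) (hdrift t)
      _ = (1 - κ) * μ[Φ t] + κ * b := by
          rw [integral_add ((hint t).const_mul _) (integrable_const _), integral_const_mul]
          simp
      _ ≤ (1 - κ) * b + κ * b := by
          have := sub_nonneg.2 hκ
          gcongr
      _ = b := by ring

theorem ae_eventually_lt_sq_of_integral_le [IsFiniteMeasure μ] {Φ : ℕ → Ω → ℝ} {b : ℝ}
    (hnonneg : ∀ t, 0 ≤ᵐ[μ] Φ t) (hint : ∀ t, Integrable (Φ t) μ) (hb : ∀ t, μ[Φ t] ≤ b) :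
    ∀ᵐ ω ∂μ, ∀ᶠ t : ℕ in atTop, Φ t ω < (t : ℝ) ^ 2 := by
  have hmarkov : ∀ᶠ t : ℕ in atTop,
      μ {ω | (t : ℝ) ^ 2 ≤ Φ t ω} ≤ ENNReal.ofReal (b * (1 / (t : ℝ) ^ 2)) := by
    filter_upwards [eventually_gt_atTop 0] with t ht
    rw [← ofReal_measureReal, mul_one_div]
    refine ENNReal.ofReal_le_ofReal ((le_div_iff₀' (by positivity)).2 ?_)
    exact (mul_meas_ge_le_integral_of_nonneg (hnonneg t) (hint t) _).trans (hb t)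
  have hsummable : Summable fun t : ℕ => b * (1 / (t : ℝ) ^ 2) :=
    (Real.summable_one_div_nat_pow.2 one_lt_two).mul_left b
  filter_upwards [ae_eventually_notMem_of_summable hsummable hmarkov] with ω hω
  exact hω.mono fun t ht => not_le.1 ht

theorem integrable_sq_of_abs_le [IsFiniteMeasure μ] {X : Ω → ℝ} {K : ℝ}
    (hX : AEStronglyMeasurable X μ) (hK : ∀ᵐ ω ∂μ, |X ω| ≤ K) :
    Integrable (fun ω => X ω ^ 2) μ :=
  Integrable.of_bound (hX.pow 2) (K ^ 2) <| hK.mono fun ω h => by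
    rw [Real.norm_of_nonneg (sq_nonneg _)]
    exact sq_le_sq' (abs_le.1 h).1 (abs_le.1 h).2

theorem condExp_sq_le [IsFiniteMeasure μ] (hm : m ≤ m0) {X : Ω → ℝ} {K : ℝ}
    (hX : AEStronglyMeasurable X μ) (hK : ∀ᵐ ω ∂μ, |X ω| ≤ K) :
    μ[fun ω => X ω ^ 2 | m] ≤ᵐ[μ] fun _ => K ^ 2 := by
  simpa only [condExp_const hm] using condExp_mono (m := m) (integrable_sq_of_abs_le hX hK)
    (integrable_const (K ^ 2)) (hK.mono fun ω h => sq_le_sq' (abs_le.1 h).1 (abs_le.1 h).2)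

theorem integrable_exp_add {X Y : Ω → ℝ} {δ : ℝ} (hX : AEStronglyMeasurable X μ)
    (hXδ : ∀ᵐ ω ∂μ, |X ω| ≤ δ) (hY : Integrable (fun ω => Real.exp (Y ω)) μ) :
    Integrable (fun ω => Real.exp (Y ω + X ω)) μ := by
  simp only [Real.exp_add]
  refine hY.mul_bdd (c := Real.exp δ) (Real.continuous_exp.comp_aestronglyMeasurable hX) ?_
  filter_upwards [hXδ] with ω h
  rw [Real.norm_of_nonneg (Real.exp_nonneg _)]
  exact Real.exp_le_exp.2 ((le_abs_self _).trans h)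

theorem condExp_one_add_mul_add_mul_sq [IsFiniteMeasure μ] (hm : m ≤ m0) {X : Ω → ℝ}
    (hX : Integrable X μ) (hX2 : Integrable (fun ω => X ω ^ 2) μ) (r a : ℝ) :
    μ[fun ω => 1 + r * X ω + a * X ω ^ 2 | m] =ᵐ[μ]
      fun ω => 1 + r * (μ[X | m]) ω + a * (μ[fun ω => X ω ^ 2 | m]) ω := by
  filter_upwards [condExp_add ((integrable_const (1 : ℝ)).add (hX.smul r)) (hX2.smul a) m,
    condExp_add (integrable_const (1 : ℝ)) (hX.smul r) m,
    condExp_smul r X m, condExp_smul a (fun ω => X ω ^ 2) m] with ω h1 h2 h3 h4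
  rw [Pi.add_apply, h2, Pi.add_apply, h3, h4, condExp_const hm] at h1
  exact h1

theorem condExp_exp_add_mul_le [IsFiniteMeasure μ] (hm : m ≤ m0) {X Y : Ω → ℝ} {K r δ : ℝ}
    (hX : AEStronglyMeasurable X μ) (hK : ∀ᵐ ω ∂μ, |X ω| ≤ K) (hr : |r| * K ≤ δ) (hδ : δ ≤ 1)
    (hY : StronglyMeasurable[m] Y) (hYint : Integrable (fun ω => Real.exp (Y ω)) μ) :
    μ[fun ω => Real.exp (Y ω + r * X ω) | m] ≤ᵐ[μ] fun ω => Real.exp (Y ω) *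
      (1 + r * (μ[X | m]) ω + (1 + δ) / 2 * r ^ 2 * (μ[fun ω => X ω ^ 2 | m]) ω) := by
  let E : Ω → ℝ := fun ω => Real.exp (Y ω)
  let Q : Ω → ℝ := fun ω => 1 + r * X ω + (1 + δ) / 2 * r ^ 2 * X ω ^ 2
  have hrX : ∀ᵐ ω ∂μ, |r * X ω| ≤ δ := hK.mono fun ω h => by
    rw [abs_mul]
    exact (mul_le_mul_of_nonneg_left h (abs_nonneg r)).trans hr
  have hXint : Integrable X μ := Integrable.of_bound hX K hK
  have hX2int : Integrable (fun ω => X ω ^ 2) μ := integrable_sq_of_abs_le hX hK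
  have hQint : Integrable Q μ :=
    ((integrable_const 1).add (hXint.const_mul r)).add (hX2int.const_mul _)
  have hexpQ : ∀ᵐ ω ∂μ, Real.exp (r * X ω) ≤ Q ω := hrX.mono fun ω h =>
    (exp_le_one_add_add_mul_sq h hδ).trans_eq (by ring)
  have hQle : ∀ᵐ ω ∂μ, ‖Q ω‖ ≤ 3 := by
    filter_upwards [hrX, hexpQ] with ω h hQ
    rw [Real.norm_of_nonneg ((Real.exp_nonneg _).trans hQ)]
    have hδ0 := (abs_nonneg _).trans h
    have := abs_le.1 h
    simp only [Q]
    nlinarith [sq_nonneg (r * X ω), sq_le_sq' this.1 this.2, mul_le_mul hδ hδ hδ0 zero_le_one]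
  have hEQint : Integrable (E * Q) μ := hYint.mul_bdd hQint.aestronglyMeasurable hQle
  have hmono : μ[fun ω => Real.exp (Y ω + r * X ω) | m] ≤ᵐ[μ] μ[E * Q | m] := by
    refine condExp_mono (integrable_exp_add (hX.const_mul r) hrX hYint) hEQint ?_
    filter_upwards [hexpQ] with ω h
    rw [Real.exp_add]
    exact mul_le_mul_of_nonneg_left h (Real.exp_nonneg _)
  filter_upwards [hmono, condExp_one_add_mul_add_mul_sq hm hXint hX2int r ((1 + δ) / 2 * r ^ 2),
    condExp_mul_of_stronglyMeasurable_left (Real.continuous_exp.comp_stronglyMeasurable hY)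
      hEQint hQint] with ω hle hQ hpull
  rwa [hpull, Pi.mul_apply, hQ] at hle

end Supermartingale

section IteratedLogarithm

variable {Ω : Type*} {m0 : MeasurableSpace Ω} {μ : Measure Ω} {ℱ : Filtration ℕ m0}
  {S : ℕ → Ω → ℝ} {K r s δ : ℝ}

/-- The predictable quadratic variation of `S`: the sum over the steps before time `t` of the
conditional second moments of the increments. -/
noncomputable def predictableVariation (S : ℕ → Ω → ℝ) (ℱ : Filtration ℕ m0) (μ : Measure Ω)
    (t : ℕ) (ω : Ω) : ℝ :=
  ∑ l ∈ Finset.range t, (μ[fun ω => (S (l + 1) ω - S l ω) ^ 2 | ℱ l]) ω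

/-- The exponential of `r * S` compensated by its predictable variation. The factor `(1 + δ) / 2`
exceeds the `1 / 2` of the Gaussian case to make this a supermartingale when `r` is small. -/
noncomputable def tiltedExp (S : ℕ → Ω → ℝ) (ℱ : Filtration ℕ m0) (μ : Measure Ω) (δ r : ℝ)
    (t : ℕ) (ω : Ω) : ℝ :=
  Real.exp (r * S t ω - (1 + δ) / 2 * (r ^ 2 * predictableVariation S ℱ μ t ω))

theorem predictableVariation_succ (t : ℕ) (ω : Ω) :
    predictableVariation S ℱ μ (t + 1) ω = predictableVariation S ℱ μ t ω +
      (μ[fun ω => (S (t + 1) ω - S t ω) ^ 2 | ℱ t]) ω :=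
  Finset.sum_range_succ _ t

theorem predictableVariation_le_succ (t : ℕ) :
    predictableVariation S ℱ μ t ≤ᵐ[μ] predictableVariation S ℱ μ (t + 1) := by
  filter_upwards [condExp_nonneg (m := ℱ t) (.of_forall fun ω => sq_nonneg (S (t + 1) ω - S t ω))]
    with ω h
  rw [predictableVariation_succ]
  exact le_add_of_nonneg_right h

theorem stronglyMeasurable_predictableVariation_succ (t : ℕ) :
    StronglyMeasurable[ℱ t] (predictableVariation S ℱ μ (t + 1)) :=
  Finset.stronglyMeasurable_fun_sum _ fun _ hl => stronglyMeasurable_condExp.mono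
    (ℱ.mono (Nat.le_of_lt_succ (Finset.mem_range.1 hl)))

theorem stronglyAdapted_predictableVariation :
    StronglyAdapted ℱ (predictableVariation S ℱ μ)
  | 0 => stronglyMeasurable_const
  | t + 1 => (stronglyMeasurable_predictableVariation_succ t).mono (ℱ.mono t.le_succ)

theorem predictableVariation_neg :
    predictableVariation (-S) ℱ μ = predictableVariation S ℱ μ := by
  funext t ω
  simp only [predictableVariation, Pi.neg_apply, neg_sub_neg, sub_sq_comm]

theorem aestronglyMeasurable_increment (hS : StronglyAdapted ℱ S) (t : ℕ) :
    AEStronglyMeasurable (fun ω => S (t + 1) ω - S t ω) μ := by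
  have h (l : ℕ) : StronglyMeasurable (S l) := (hS l).mono (ℱ.le l)
  exact ((h (t + 1)).sub (h t)).aestronglyMeasurable

theorem predictableVariation_le [IsFiniteMeasure μ] (hS : StronglyAdapted ℱ S)
    (hK : ∀ t, ∀ᵐ ω ∂μ, |S (t + 1) ω - S t ω| ≤ K) :
    ∀ᵐ ω ∂μ, ∀ t, predictableVariation S ℱ μ t ω ≤ K ^ 2 * t := by
  have hstep (t : ℕ) : ∀ᵐ ω ∂μ, (μ[fun ω => (S (t + 1) ω - S t ω) ^ 2 | ℱ t]) ω ≤ K ^ 2 :=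
    condExp_sq_le (ℱ.le t) (aestronglyMeasurable_increment hS t) (hK t)
  filter_upwards [ae_all_iff.2 hstep] with ω h t
  refine (Finset.sum_le_card_nsmul _ _ _ fun l _ => h l).trans_eq ?_
  rw [Finset.card_range, nsmul_eq_mul, mul_comm]

theorem tiltedExp_succ (t : ℕ) (ω : Ω) :
    tiltedExp S ℱ μ δ r (t + 1) ω =
      Real.exp (r * S t ω - (1 + δ) / 2 * (r ^ 2 * predictableVariation S ℱ μ (t + 1) ω) +
        r * (S (t + 1) ω - S t ω)) := by
  rw [tiltedExp]
  ring_nf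

theorem integrable_exp_of_integrable_tiltedExp (hS : StronglyAdapted ℱ S) (hδ : 0 ≤ δ) {t : ℕ}
    (hint : Integrable (tiltedExp S ℱ μ δ r t) μ) :
    Integrable (fun ω => Real.exp
      (r * S t ω - (1 + δ) / 2 * (r ^ 2 * predictableVariation S ℱ μ (t + 1) ω))) μ := by
  refine hint.mono' ?_ ?_
  · exact (Real.continuous_exp.comp_stronglyMeasurable <| ((hS t).const_mul r).sub
      (((stronglyMeasurable_predictableVariation_succ t).const_mul _).const_mul _)).mono
        (ℱ.le t) |>.aestronglyMeasurable
  · filter_upwards [predictableVariation_le_succ t] with ω h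
    rw [Real.norm_of_nonneg (Real.exp_nonneg _), tiltedExp]
    gcongr

theorem integrable_tiltedExp [IsFiniteMeasure μ] (hS : StronglyAdapted ℱ S) (hS0 : S 0 = 0)
    (hK : ∀ t, ∀ᵐ ω ∂μ, |S (t + 1) ω - S t ω| ≤ K) (hδ : 0 ≤ δ) (t : ℕ) :
    Integrable (tiltedExp S ℱ μ δ r t) μ := by
  induction t with
  | zero =>
    refine (integrable_const (1 : ℝ)).congr (.of_forall fun ω => ?_)
    simp only [tiltedExp, predictableVariation, hS0, Pi.zero_apply, Finset.range_zero,
      Finset.sum_empty, mul_zero, sub_zero, Real.exp_zero]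
  | succ t ih =>
    simp only [funext (tiltedExp_succ t)]
    refine integrable_exp_add (δ := |r| * K) ?_ ?_ (integrable_exp_of_integrable_tiltedExp hS hδ ih)
    · exact (aestronglyMeasurable_increment hS t).const_mul r
    · filter_upwards [hK t] with ω h
      rw [abs_mul]
      gcongr

theorem supermartingale_tiltedExp [IsFiniteMeasure μ] (hS : Supermartingale S ℱ μ)
    (hS0 : S 0 = 0) (hK : ∀ t, ∀ᵐ ω ∂μ, |S (t + 1) ω - S t ω| ≤ K) (hr : 0 ≤ r)
    (hδ0 : 0 ≤ δ) (hrK : r * K ≤ δ) (hδ : δ ≤ 1) :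
    Supermartingale (tiltedExp S ℱ μ δ r) ℱ μ := by
  have hadapted : StronglyAdapted ℱ (tiltedExp S ℱ μ δ r) := fun t =>
    Real.continuous_exp.comp_stronglyMeasurable <| ((hS.stronglyAdapted t).const_mul r).sub
      (((stronglyAdapted_predictableVariation t).const_mul _).const_mul _)
  have hint := integrable_tiltedExp (r := r) hS.stronglyAdapted hS0 hK hδ0
  refine supermartingale_nat hadapted hint fun t => ?_
  have hdrift : μ[fun ω => S (t + 1) ω - S t ω | ℱ t] ≤ᵐ[μ] 0 := by
    filter_upwards [condExp_sub (hS.integrable (t + 1)) (hS.integrable t) (ℱ t),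
      hS.condExp_ae_le t.le_succ] with ω hsub hle
    refine hsub.trans_le (sub_nonpos.2 ?_)
    rwa [condExp_of_stronglyMeasurable (ℱ.le t) (hS.stronglyMeasurable t) (hS.integrable t)]
  have hexp := condExp_exp_add_mul_le (ℱ.le t)
    (aestronglyMeasurable_increment hS.stronglyAdapted t) (hK t) (by rwa [abs_of_nonneg hr]) hδ
    (Y := fun ω => r * S t ω - (1 + δ) / 2 * (r ^ 2 * predictableVariation S ℱ μ (t + 1) ω))
    (((hS.stronglyAdapted t).const_mul r).sub
      (((stronglyMeasurable_predictableVariation_succ t).const_mul _).const_mul _))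
    (integrable_exp_of_integrable_tiltedExp hS.stronglyAdapted hδ0 (hint t))
  simp only [funext (tiltedExp_succ t)]
  filter_upwards [hexp, hdrift] with ω hexp hdrift
  refine hexp.trans ?_
  calc _ ≤ Real.exp (r * S t ω - (1 + δ) / 2 * (r ^ 2 * predictableVariation S ℱ μ (t + 1) ω)) *
        Real.exp ((1 + δ) / 2 * r ^ 2 *
          (μ[fun ω => (S (t + 1) ω - S t ω) ^ 2 | ℱ t]) ω) := by
        refine mul_le_mul_of_nonneg_left ?_ (Real.exp_nonneg _)
        refine le_trans ?_ (Real.add_one_le_exp _)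
        have := mul_nonpos_of_nonneg_of_nonpos hr hdrift
        linarith
    _ = tiltedExp S ℱ μ δ r t ω := by
        rw [← Real.exp_add, tiltedExp, predictableVariation_succ]
        ring_nf

theorem measure_exists_le_log_tiltedExp_le [IsProbabilityMeasure μ] (hS : Supermartingale S ℱ μ)
    (hS0 : S 0 = 0) (hK : ∀ t, ∀ᵐ ω ∂μ, |S (t + 1) ω - S t ω| ≤ K) (hr : 0 ≤ r)
    (hδ0 : 0 ≤ δ) (hrK : r * K ≤ δ) (hδ : δ ≤ 1) (x : ℝ) :
    μ {ω | ∃ t, x ≤ r * S t ω - (1 + δ) / 2 * (r ^ 2 * predictableVariation S ℱ μ t ω)} ≤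
      ENNReal.ofReal (Real.exp (-x)) := by
  have hville := measure_exists_ge_le_of_supermartingale
    (supermartingale_tiltedExp hS hS0 hK hr hδ0 hrK hδ)
    (fun t ω => (Real.exp_nonneg _)) (Real.exp_pos x)
  simpa [tiltedExp, Real.exp_le_exp, predictableVariation, hS0, Real.exp_neg] using hville

theorem ae_eventually_le_mul_phi_of_predictableVariation_le [IsProbabilityMeasure μ]
    (hS : Supermartingale S ℱ μ) (hS0 : S 0 = 0)
    (hK : ∀ t, ∀ᵐ ω ∂μ, |S (t + 1) ω - S t ω| ≤ K) (hs : 0 < s) (hδ0 : 0 < δ) (hδ : δ ≤ 1) :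
    ∀ᵐ ω ∂μ, (∀ᶠ t : ℕ in atTop, predictableVariation S ℱ μ t ω ≤ s ^ 2 * t) →
      ∀ᶠ t in atTop, S t ω ≤ (1 + δ) ^ 3 * s * phi t := by
  have hsmall : ∀ᶠ k in atTop, blockTilt δ k / s * K ≤ δ := by
    have hlim := ((tendsto_blockTilt_zero hδ0).div_const s).mul_const K
    rw [zero_div, zero_mul] at hlim
    exact hlim.eventually_le_const hδ0
  have hblock : ∀ᶠ k : ℕ in atTop,
      μ {ω | ∃ t, (1 + δ) * Real.log k ≤ blockTilt δ k / s * S t ω -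
        (1 + δ) / 2 * ((blockTilt δ k / s) ^ 2 * predictableVariation S ℱ μ t ω)} ≤
      ENNReal.ofReal ((k : ℝ) ^ (-(1 + δ))) := by
    filter_upwards [hsmall, eventually_gt_atTop 0] with k hk hkpos
    refine (measure_exists_le_log_tiltedExp_le hS hS0 hK
      (div_nonneg (Real.sqrt_nonneg _) hs.le) hδ0.le hk hδ _).trans_eq ?_
    rw [Real.rpow_def_of_pos (Nat.cast_pos.2 hkpos), mul_neg, mul_comm (Real.log _)]
  have hsummable : Summable fun k : ℕ => (k : ℝ) ^ (-(1 + δ)) :=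
    Real.summable_nat_rpow.2 (by linarith)
  filter_upwards [ae_eventually_notMem_of_summable hsummable hblock] with ω hω hV
  refine eventually_le_phi_of_blockTilt hs hδ0 hV (hω.mono fun k hk t => ?_)
  exact (not_le.1 fun h => hk ⟨t, h⟩).le

theorem exists_rat_one_add_pow_three_mul_lt {x : ℝ} (hs : 0 ≤ s) (hsx : s < x) :
    ∃ a δ : ℚ, s ≤ a ∧ (0 : ℝ) < a ∧ (0 : ℝ) < δ ∧ (δ : ℝ) ≤ 1 ∧ (1 + δ : ℝ) ^ 3 * a < x := by
  obtain ⟨a, hsa, hax⟩ := exists_rat_btwn hsx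
  have hlim : Tendsto (fun n : ℕ => (1 + 1 / ((n : ℝ) + 1)) ^ 3 * (a : ℝ)) atTop (𝓝 (a : ℝ)) := by
    simpa only [add_zero, one_pow, one_mul] using
      ((tendsto_one_div_add_atTop_nhds_zero_nat.const_add (1 : ℝ)).pow 3).mul_const (a : ℝ)
  obtain ⟨n, hn⟩ := (hlim.eventually_lt_const hax).exists
  refine ⟨a, 1 / (n + 1), hsa.le, hs.trans_lt hsa, ?_, ?_, ?_⟩ <;> push_cast
  · positivity
  · exact (div_le_one (by positivity)).2 (le_add_of_nonneg_left n.cast_nonneg)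
  · exact hn

theorem ae_forall_eventually_le_mul_phi [IsProbabilityMeasure μ]
    (hS : Supermartingale S ℱ μ) (hS0 : S 0 = 0)
    (hK : ∀ t, ∀ᵐ ω ∂μ, |S (t + 1) ω - S t ω| ≤ K) :
    ∀ᵐ ω ∂μ, ∀ s x : ℝ, 0 ≤ s → s < x →
      (∀ᶠ t : ℕ in atTop, predictableVariation S ℱ μ t ω ≤ s ^ 2 * t) →
      ∀ᶠ t in atTop, S t ω ≤ x * phi t := by
  have hrat : ∀ᵐ ω ∂μ, ∀ a δ : ℚ, (0 : ℝ) < a → (0 : ℝ) < δ → (δ : ℝ) ≤ 1 →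
      (∀ᶠ t : ℕ in atTop, predictableVariation S ℱ μ t ω ≤ (a : ℝ) ^ 2 * t) →
      ∀ᶠ t in atTop, S t ω ≤ (1 + δ : ℝ) ^ 3 * a * phi t := by
    simp only [ae_all_iff, eventually_imp_distrib_left]
    exact fun a δ ha hδ0 hδ =>
      ae_eventually_le_mul_phi_of_predictableVariation_le hS hS0 hK ha hδ0 hδ
  filter_upwards [hrat] with ω hω s x hs hsx hV
  obtain ⟨a, δ, hsa, ha, hδ0, hδ, hx⟩ := exists_rat_one_add_pow_three_mul_lt hs hsx
  have hVa : ∀ᶠ t : ℕ in atTop, predictableVariation S ℱ μ t ω ≤ (a : ℝ) ^ 2 * t :=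
    hV.mono fun t h => h.trans (by gcongr)
  filter_upwards [hω a δ ha hδ0 hδ hVa] with t ht
  exact ht.trans (mul_le_mul_of_nonneg_right hx.le (phi_nonneg t))

theorem ae_isLittleO_natCast_of_martingale [IsProbabilityMeasure μ] (hS : Martingale S ℱ μ)
    (hS0 : S 0 = 0) (hK : ∀ t, ∀ᵐ ω ∂μ, |S (t + 1) ω - S t ω| ≤ K) :
    ∀ᵐ ω ∂μ, (fun t => S t ω) =o[atTop] fun t : ℕ => (t : ℝ) := by
  have hKneg (t : ℕ) : ∀ᵐ ω ∂μ, |(-S) (t + 1) ω - (-S) t ω| ≤ K := by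
    simpa only [Pi.neg_apply, neg_sub_neg, abs_sub_comm] using hK t
  filter_upwards [ae_forall_eventually_le_mul_phi hS.supermartingale hS0 hK,
    ae_forall_eventually_le_mul_phi hS.neg.supermartingale (neg_eq_zero.2 hS0) hKneg,
    predictableVariation_le hS.stronglyAdapted hK] with ω hupper hlower hV
  have hV' : ∀ᶠ t : ℕ in atTop, predictableVariation S ℱ μ t ω ≤ |K| ^ 2 * t :=
    .of_forall fun t => by simpa only [sq_abs] using hV t
  refine IsBigO.trans_isLittleO (IsBigO.of_bound (|K| + 1) ?_) phi_isLittleO_natCast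
  rw [predictableVariation_neg] at hlower
  filter_upwards [hupper |K| (|K| + 1) (abs_nonneg K) (lt_add_one _) hV',
    hlower |K| (|K| + 1) (abs_nonneg K) (lt_add_one _) hV'] with t hle hge
  rw [Real.norm_eq_abs, Real.norm_of_nonneg (phi_nonneg t)]
  exact abs_le'.2 ⟨hle, hge⟩

end IteratedLogarithm

section Slots

variable {Ω : Type*} {N : ℕ} {p : Fin N → ℝ} {served : ℕ → Ω → Fin N} {success : ℕ → Set Ω}

/-- The outcome of the transmission in slot `t`: `1` for a success and `0` for a failure. -/
noncomputable def outcome (success : ℕ → Set Ω) (t : ℕ) (ω : Ω) : ℝ :=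
  (success t).indicator (fun _ => 1) ω

/-- The reward accumulated before slot `t` when serving client `k` with outcome `b` is worth
`f k b`. -/
noncomputable def slotSum (served : ℕ → Ω → Fin N) (success : ℕ → Set Ω) (f : Fin N → ℝ → ℝ)
    (t : ℕ) (ω : Ω) : ℝ :=
  ∑ l ∈ Finset.range t, f (served l ω) (outcome success l ω)

/-- The mean of the reward `f k b` when the outcome `b` of serving client `k` is a Bernoulli
variable of parameter `p k`. -/
noncomputable def slotMean (p : Fin N → ℝ) (f : Fin N → ℝ → ℝ) (k : Fin N) : ℝ :=
  (1 - p k) * f k 0 + p k * f k 1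

/-- The number of slots before `t` in which client `j` is served. -/
noncomputable def attempts (served : ℕ → Ω → Fin N) (j : Fin N) (t : ℕ) (ω : Ω) : ℝ :=
  ∑ l ∈ Finset.range t, if served l ω = j then 1 else 0

theorem outcome_eq_zero_or_one (t : ℕ) (ω : Ω) :
    outcome success t ω = 0 ∨ outcome success t ω = 1 :=
  Set.indicator_eq_zero_or_self _ _ _

theorem apply_outcome (g : ℝ → ℝ) (t : ℕ) (ω : Ω) :
    g (outcome success t ω) = g 0 + (g 1 - g 0) * outcome success t ω := by
  rcases outcome_eq_zero_or_one (success := success) t ω with h | h <;> rw [h] <;> ring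

theorem slotSum_zero (f : Fin N → ℝ → ℝ) : slotSum served success f 0 = 0 := rfl

theorem slotSum_succ_sub (f : Fin N → ℝ → ℝ) (t : ℕ) (ω : Ω) :
    slotSum served success f (t + 1) ω - slotSum served success f t ω =
      f (served t ω) (outcome success t ω) :=
  Finset.sum_range_succ_sub_sum _

theorem sum_served_eq_sum_attempts_mul (g : Fin N → ℝ) (t : ℕ) (ω : Ω) :
    ∑ l ∈ Finset.range t, g (served l ω) = ∑ j, attempts served j t ω * g j := by
  simp only [attempts, Finset.sum_mul, ite_mul, one_mul, zero_mul]
  rw [Finset.sum_comm]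
  simp only [Finset.sum_ite_eq, Finset.mem_univ, if_true]

theorem exists_forall_abs_reward_le {ι : Type*} [Finite ι] (f : ι → Fin N → ℝ → ℝ)
    (served : ℕ → Ω → Fin N) (success : ℕ → Set Ω) :
    ∃ K, ∀ i t ω, |f i (served t ω) (outcome success t ω)| ≤ K := by
  obtain ⟨K, hK⟩ :=
    (Set.finite_range fun x : ι × Fin N => max |f x.1 x.2 0| |f x.1 x.2 1|).bddAbove
  refine ⟨K, fun i t ω => le_trans ?_ (hK (Set.mem_range_self (i, served t ω)))⟩
  rcases outcome_eq_zero_or_one (success := success) t ω with h | h <;> rw [h]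
  exacts [le_max_left _ _, le_max_right _ _]

theorem abs_slotSum_le {f : Fin N → ℝ → ℝ} {K : ℝ}
    (hK : ∀ t ω, |f (served t ω) (outcome success t ω)| ≤ K) (t : ℕ) (ω : Ω) :
    |slotSum served success f t ω| ≤ t * K :=
  abs_le_mul_of_abs_sub_le (u := fun t => slotSum served success f t ω)
    (congrFun (slotSum_zero f) ω) (fun t => by simpa only [slotSum_succ_sub] using hK t ω) t

variable [mΩ : MeasurableSpace Ω] {μ : Measure Ω} {ℱ : Filtration ℕ mΩ}

namespace IsSlottedNetwork

theorem stronglyMeasurable_comp_served (network : IsSlottedNetwork μ ℱ p served success)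
    (g : Fin N → ℝ) (t : ℕ) : StronglyMeasurable[ℱ t] fun ω => g (served t ω) :=
  ((measurable_of_finite g).comp (network.served_measurable t)).stronglyMeasurable

theorem stronglyMeasurable_outcome (network : IsSlottedNetwork μ ℱ p served success) (t : ℕ) :
    StronglyMeasurable[ℱ (t + 1)] (outcome success t) :=
  stronglyMeasurable_const.indicator (network.success_measurable t)

theorem stronglyMeasurable_reward (network : IsSlottedNetwork μ ℱ p served success)
    (f : Fin N → ℝ → ℝ) (t : ℕ) :
    StronglyMeasurable[ℱ (t + 1)] fun ω => f (served t ω) (outcome success t ω) := by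
  have hserved (g : Fin N → ℝ) : StronglyMeasurable[ℱ (t + 1)] fun ω => g (served t ω) :=
    (network.stronglyMeasurable_comp_served g t).mono (ℱ.mono t.le_succ)
  simp only [apply_outcome (f _)]
  exact (hserved fun k => f k 0).add
    ((hserved fun k => f k 1 - f k 0).mul (network.stronglyMeasurable_outcome t))

theorem stronglyAdapted_slotSum (network : IsSlottedNetwork μ ℱ p served success)
    (f : Fin N → ℝ → ℝ) : StronglyAdapted ℱ (slotSum served success f) := fun _ =>
  Finset.stronglyMeasurable_fun_sum _ fun l hl =>
    (network.stronglyMeasurable_reward f l).mono (ℱ.mono (Finset.mem_range.1 hl))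

theorem integrable_reward [IsFiniteMeasure μ]
    (network : IsSlottedNetwork μ ℱ p served success)
    (f : Fin N → ℝ → ℝ) (t : ℕ) :
    Integrable (fun ω => f (served t ω) (outcome success t ω)) μ := by
  obtain ⟨K, hK⟩ := exists_forall_abs_reward_le (fun _ : Unit => f) served success
  exact .of_bound ((network.stronglyMeasurable_reward f t).mono (ℱ.le _)).aestronglyMeasurable K
    (.of_forall (hK () t))

theorem condExp_reward [IsFiniteMeasure μ]
    (network : IsSlottedNetwork μ ℱ p served success)
    (f : Fin N → ℝ → ℝ) (t : ℕ) :
    μ[fun ω => f (served t ω) (outcome success t ω) | ℱ t] =ᵐ[μ]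
      fun ω => slotMean p f (served t ω) := by
  let g₀ : Ω → ℝ := fun ω => f (served t ω) 0
  let g₁ : Ω → ℝ := fun ω => f (served t ω) 1 - f (served t ω) 0
  have hsplit : (fun ω => f (served t ω) (outcome success t ω)) = g₀ + g₁ * outcome success t :=
    funext fun ω => apply_outcome (f (served t ω)) t ω
  have hg₀ : StronglyMeasurable[ℱ t] g₀ := network.stronglyMeasurable_comp_served (f · 0) t
  have hg₁ : StronglyMeasurable[ℱ t] g₁ :=
    network.stronglyMeasurable_comp_served (fun k => f k 1 - f k 0) t
  have hint₀ : Integrable g₀ μ := network.integrable_reward (fun k _ => f k 0) t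
  have hint : Integrable (g₁ * outcome success t) μ :=
    network.integrable_reward (fun k b => (f k 1 - f k 0) * b) t
  rw [hsplit]
  filter_upwards [condExp_add hint₀ hint (ℱ t), network.success_prob t,
    condExp_mul_of_stronglyMeasurable_left hg₁ hint (network.integrable_reward (fun _ b => b) t)]
    with ω hadd hprob hpull
  rw [hadd, Pi.add_apply, condExp_of_stronglyMeasurable (ℱ.le t) hg₀ hint₀, hpull, Pi.mul_apply]
  refine (congrArg (fun x => g₀ ω + g₁ ω * x) hprob).trans ?_
  simp only [g₀, g₁, slotMean]
  ring

theorem martingale_slotSum [IsFiniteMeasure μ]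
    (network : IsSlottedNetwork μ ℱ p served success)
    {f : Fin N → ℝ → ℝ} (hf : ∀ k, slotMean p f k = 0) :
    Martingale (slotSum served success f) ℱ μ := by
  refine martingale_of_condExp_sub_eq_zero_nat (network.stronglyAdapted_slotSum f)
    (fun t => integrable_finsetSum _ fun l _ => network.integrable_reward f l) fun t => ?_
  have hincr : slotSum served success f (t + 1) - slotSum served success f t =
      fun ω => f (served t ω) (outcome success t ω) := funext (slotSum_succ_sub f t)
  rw [hincr]
  filter_upwards [network.condExp_reward f t] with ω h
  rw [h, hf, Pi.zero_apply]

theorem ae_predictableVariation_slotSum_eq [IsFiniteMeasure μ]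
    (network : IsSlottedNetwork μ ℱ p served success)
    (f : Fin N → ℝ → ℝ) :
    ∀ᵐ ω ∂μ, ∀ t, predictableVariation (slotSum served success f) ℱ μ t ω =
      ∑ j, attempts served j t ω * slotMean p (fun k b => f k b ^ 2) j := by
  filter_upwards [ae_all_iff.2 fun t => network.condExp_reward (fun k b => f k b ^ 2) t]
    with ω hω t
  simp only [predictableVariation, slotSum_succ_sub, hω, ← sum_served_eq_sum_attempts_mul]

theorem ae_slotSum_isLittleO [IsProbabilityMeasure μ]
    (network : IsSlottedNetwork μ ℱ p served success)
    {f : Fin N → ℝ → ℝ} (hf : ∀ k, slotMean p f k = 0) :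
    ∀ᵐ ω ∂μ, (fun t => slotSum served success f t ω) =o[atTop] fun t : ℕ => (t : ℝ) := by
  obtain ⟨K, hK⟩ := exists_forall_abs_reward_le (fun _ : Unit => f) served success
  refine ae_isLittleO_natCast_of_martingale (network.martingale_slotSum hf) (slotSum_zero f)
    (K := K) fun t => .of_forall fun ω => ?_
  simpa only [slotSum_succ_sub] using hK () t ω

theorem ae_forall_eventually_slotSum_le_mul_phi [IsProbabilityMeasure μ]
    (network : IsSlottedNetwork μ ℱ p served success)
    {f : Fin N → ℝ → ℝ} (hf : ∀ k, slotMean p f k = 0) :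
    ∀ᵐ ω ∂μ, ∀ s x : ℝ, 0 ≤ s → s < x →
      (∀ᶠ t : ℕ in atTop,
        ∑ j, attempts served j t ω * slotMean p (fun k b => f k b ^ 2) j ≤ s ^ 2 * t) →
      ∀ᶠ t in atTop, slotSum served success f t ω ≤ x * phi t := by
  obtain ⟨K, hK⟩ := exists_forall_abs_reward_le (fun _ : Unit => f) served success
  have hincr (t : ℕ) : ∀ᵐ ω ∂μ,
      |slotSum served success f (t + 1) ω - slotSum served success f t ω| ≤ K :=
    .of_forall fun ω => by simpa only [slotSum_succ_sub] using hK () t ω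
  filter_upwards [network.ae_predictableVariation_slotSum_eq f, ae_forall_eventually_le_mul_phi
    (network.martingale_slotSum hf).supermartingale (slotSum_zero f) hincr] with ω hvar hω
  simpa only [hvar] using hω

end IsSlottedNetwork

end Slots

section Debts

variable {Ω : Type*} {N : ℕ} {p q : Fin N → ℝ} {served : ℕ → Ω → Fin N} {success : ℕ → Set Ω}

/-- The sum of the weighted debts `d_k(t) / p_k` of all clients. -/
noncomputable def totalDebt (p q : Fin N → ℝ) (served : ℕ → Ω → Fin N) (success : ℕ → Set Ω)
    (t : ℕ) (ω : Ω) : ℝ :=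
  ∑ k, debt q served success k t ω / p k

/-- The excess of the weighted debt of client `j` over the average weighted debt: the coordinate
of the vector of weighted debts transverse to the diagonal. -/
noncomputable def excess (p q : Fin N → ℝ) (served : ℕ → Ω → Fin N) (success : ℕ → Set Ω)
    (j : Fin N) (t : ℕ) (ω : Ω) : ℝ :=
  debt q served success j t ω / p j - totalDebt p q served success t ω / N

/-- The increment of the excess of client `j` when client `k` is served with outcome `b`. -/
noncomputable def excessStep (p q : Fin N → ℝ) (j k : Fin N) (b : ℝ) : ℝ :=
  q j / p j - (if k = j then b / p j else 0) - (1 - b / p k) / N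

theorem debt_eq_slotSum (j : Fin N) (t : ℕ) (ω : Ω) :
    debt q served success j t ω =
      slotSum served success (fun k b => q j - if k = j then b else 0) t ω := by
  have hdelivered (l : ℕ) : (deliveredTo served success j l).indicator (fun _ => (1 : ℝ)) ω =
      if served l ω = j then outcome success l ω else 0 := by
    simp only [deliveredTo, outcome, Set.indicator, Set.mem_ofPred_eq]
    grind
  simp only [debt, slotSum, hdelivered, Finset.sum_sub_distrib, Finset.sum_const,
    Finset.card_range, nsmul_eq_mul]

theorem totalDebt_eq_slotSum (hyperplane : ∑ j, q j / p j = 1) (t : ℕ) (ω : Ω) :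
    totalDebt p q served success t ω = slotSum served success (fun k b => 1 - b / p k) t ω := by
  simp only [totalDebt, debt_eq_slotSum, slotSum, Finset.sum_div]
  rw [Finset.sum_comm]
  simp only [sub_div, ite_div, zero_div, Finset.sum_sub_distrib, hyperplane, Finset.sum_ite_eq,
    Finset.mem_univ, if_true]

theorem excess_eq_slotSum (hyperplane : ∑ j, q j / p j = 1) (j : Fin N) (t : ℕ) (ω : Ω) :
    excess p q served success j t ω = slotSum served success (excessStep p q j) t ω := by
  rw [excess, totalDebt_eq_slotSum hyperplane, debt_eq_slotSum]
  simp only [slotSum, excessStep, Finset.sum_div, ← Finset.sum_sub_distrib, sub_div, ite_div,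
    zero_div]

theorem debt_div_eq_sub_attempts_add (j : Fin N) (t : ℕ) (ω : Ω) :
    debt q served success j t ω / p j = t * (q j / p j) - attempts served j t ω +
      slotSum served success (fun k b => if k = j then 1 - b / p j else 0) t ω := by
  have hdrift : t * (q j / p j) = ∑ _l ∈ Finset.range t, q j / p j := by
    rw [Finset.sum_const, Finset.card_range, nsmul_eq_mul]
  rw [debt_eq_slotSum, hdrift]
  simp only [slotSum, attempts, Finset.sum_div, ← Finset.sum_sub_distrib, ← Finset.sum_add_distrib]
  refine Finset.sum_congr rfl fun l _ => ?_
  split_ifs <;> ring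

theorem debt_eq_mul_excess_add {j : Fin N} (hp : p j ≠ 0) (t : ℕ) (ω : Ω) :
    debt q served success j t ω =
      p j * (excess p q served success j t ω + totalDebt p q served success t ω / N) := by
  rw [excess, sub_add_cancel, mul_div_cancel₀ _ hp]

theorem one_le_natCast_of_sum_eq_one (hyperplane : ∑ j, q j / p j = 1) : (1 : ℝ) ≤ N := by
  rcases N.eq_zero_or_pos with rfl | hN
  · simp at hyperplane
  · exact_mod_cast hN

theorem sum_excess_eq_zero (hN : N ≠ 0) (t : ℕ) (ω : Ω) :
    ∑ j, excess p q served success j t ω = 0 := by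
  simp only [excess, Finset.sum_sub_distrib, Finset.sum_const, Finset.card_univ,
    Fintype.card_fin, nsmul_eq_mul]
  rw [mul_div_cancel₀ _ (Nat.cast_ne_zero.2 hN), totalDebt, sub_self]

theorem IsMWDF.excess_le_excess_served (mwdf : IsMWDF p q served success) (t : ℕ) (ω : Ω)
    (k : Fin N) :
    excess p q served success k t ω ≤ excess p q served success (served t ω) t ω :=
  sub_le_sub_right (mwdf t ω k) _

theorem slotMean_one_sub_div (hp : ∀ j, p j ≠ 0) (k : Fin N) :
    slotMean p (fun k b => 1 - b / p k) k = 0 := by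
  have := hp k
  simp only [slotMean]
  field_simp
  ring

theorem slotMean_sq_one_sub_div (hp : ∀ j, p j ≠ 0) (k : Fin N) :
    slotMean p (fun k b => (1 - b / p k) ^ 2) k = (1 - p k) / p k := by
  have := hp k
  simp only [slotMean]
  field_simp
  ring

theorem slotMean_ite_one_sub_div {j : Fin N} (hp : p j ≠ 0) (k : Fin N) :
    slotMean p (fun k b => if k = j then 1 - b / p j else 0) k = 0 := by
  rcases eq_or_ne k j with rfl | hk
  · simp only [slotMean, if_true]
    field_simp
    ring
  · simp only [slotMean, if_neg hk, mul_zero, add_zero]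

theorem slotMean_excessStep (hp : ∀ j, p j ≠ 0) (j k : Fin N) :
    slotMean p (excessStep p q j) k = q j / p j - if k = j then 1 else 0 := by
  have := hp k
  rcases eq_or_ne k j with rfl | hk
  · simp only [slotMean, excessStep, if_true]
    field_simp
    ring
  · simp only [slotMean, excessStep, if_neg hk]
    field_simp
    ring

end Debts

section Collapse

variable {Ω : Type*} {N : ℕ} {p q : Fin N → ℝ} {served : ℕ → Ω → Fin N} {success : ℕ → Set Ω}
  {η D ρ : ℝ}

/-- The exponential Lyapunov function of the excesses. -/
noncomputable def lyapunov (p q : Fin N → ℝ) (served : ℕ → Ω → Fin N) (success : ℕ → Set Ω)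
    (η : ℝ) (t : ℕ) (ω : Ω) : ℝ :=
  ∑ j, Real.exp (η * excess p q served success j t ω)

theorem sum_mul_sub_ite_le {r E : Fin N → ℝ} (hρ : 0 ≤ ρ) (hr : ∀ k, ρ ≤ r k)
    (hsum : ∑ k, r k = 1) {i s : Fin N} (hmax : ∀ k, E k ≤ E s) (hi : E i ≤ 1) :
    ∑ k, E k * (r k - if s = k then 1 else 0) ≤ ρ * (1 - (∑ k, E k) / N) := by
  have hmean : (∑ k, E k) / N ≤ E s := by
    rw [div_le_iff₀ (Nat.cast_pos.2 s.pos), mul_comm]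
    simpa using Finset.sum_le_card_nsmul Finset.univ E (E s) fun k _ => hmax k
  calc ∑ k, E k * (r k - if s = k then 1 else 0) = ∑ k, r k * (E k - E s) := by
        simp only [mul_sub, Finset.sum_sub_distrib, ← Finset.sum_mul, hsum, mul_ite, mul_one,
          mul_zero, Finset.sum_ite_eq, Finset.mem_univ, if_true, mul_comm]
    _ ≤ r i * (E i - E s) := by
        rw [← Finset.add_sum_erase _ _ (Finset.mem_univ i)]
        refine add_le_of_nonpos_right (Finset.sum_nonpos fun k _ => ?_)
        exact mul_nonpos_of_nonneg_of_nonpos (hρ.trans (hr k)) (sub_nonpos.2 (hmax k))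
    _ ≤ ρ * (E i - E s) := mul_le_mul_of_nonpos_right (hr i) (sub_nonpos.2 (hmax i))
    _ ≤ ρ * (1 - (∑ k, E k) / N) := by gcongr

theorem IsMWDF.sum_exp_excess_mul_le (mwdf : IsMWDF p q served success) {κ : ℝ}
    (hyperplane : ∑ j, q j / p j = 1) (hρ : 0 ≤ ρ) (hr : ∀ k, ρ ≤ q k / p k) (hη : 0 ≤ η)
    (hκ : κ * (2 * N) = η * ρ) (t : ℕ) (ω : Ω) :
    ∑ k, Real.exp (η * excess p q served success k t ω) *
        (1 + η * (q k / p k - if served t ω = k then 1 else 0) + κ) ≤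
      (1 - κ) * lyapunov p q served success η t ω + κ * (2 * N) := by
  have hN : (0 : ℝ) < N := Nat.cast_pos.2 (served t ω).pos
  obtain ⟨i, -, hi⟩ := Finset.exists_le_of_sum_le
    (f := fun j => excess p q served success j t ω) (g := fun _ => 0)
    ⟨served t ω, Finset.mem_univ _⟩
    ((sum_excess_eq_zero (served t ω).pos.ne' t ω).trans_le Finset.sum_const_zero.ge)
  have hserve := sum_mul_sub_ite_le (s := served t ω) hρ hr hyperplane
    (fun k => Real.exp_le_exp.2
      (mul_le_mul_of_nonneg_left (mwdf.excess_le_excess_served t ω k) hη))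
    (Real.exp_le_one_iff.2 (mul_nonpos_of_nonneg_of_nonpos hη hi))
  calc _ = (1 + κ) * lyapunov p q served success η t ω +
        η * ∑ k, Real.exp (η * excess p q served success k t ω) *
          (q k / p k - if served t ω = k then 1 else 0) := by
        simp only [lyapunov, Finset.mul_sum, ← Finset.sum_add_distrib]
        exact Finset.sum_congr rfl fun k _ => by ring
    _ ≤ (1 + κ) * lyapunov p q served success η t ω +
        η * (ρ * (1 - lyapunov p q served success η t ω / N)) := by
        gcongr
        exact hserve
    _ = (1 - κ) * lyapunov p q served success η t ω + κ * (2 * N) := by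
        have hdiv : η * ρ * (lyapunov p q served success η t ω / N) =
            2 * κ * lyapunov p q served success η t ω := by
          rw [← hκ]
          field_simp
        linear_combination -hκ - hdiv

theorem exists_pos_mul_le_one_sq_mul_eq {M : ℝ} (hM : 0 < M) (hD : 0 < D) (hρ : 0 < ρ)
    (hρMD : ρ ≤ M * D) : ∃ η > 0, η * D ≤ 1 ∧ η ^ 2 * D ^ 2 * M = η * ρ := by
  refine ⟨ρ / (M * D ^ 2), by positivity, ?_, by field_simp⟩
  rw [div_mul_eq_mul_div, div_le_one (by positivity), sq, ← mul_assoc]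
  gcongr

variable [mΩ : MeasurableSpace Ω] {μ : Measure Ω} {ℱ : Filtration ℕ mΩ}

namespace IsSlottedNetwork

theorem integrable_exp_mul_slotSum [IsFiniteMeasure μ]
    (network : IsSlottedNetwork μ ℱ p served success)
    (f : Fin N → ℝ → ℝ) (η : ℝ) (t : ℕ) :
    Integrable (fun ω => Real.exp (η * slotSum served success f t ω)) μ := by
  obtain ⟨K, hK⟩ := exists_forall_abs_reward_le (fun _ : Unit => f) served success
  have hmeas : StronglyMeasurable fun ω => Real.exp (η * slotSum served success f t ω) :=
    (Real.continuous_exp.comp_stronglyMeasurable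
      ((network.stronglyAdapted_slotSum f t).const_mul η)).mono (ℱ.le t)
  refine .of_bound hmeas.aestronglyMeasurable (Real.exp (|η| * (t * K))) (.of_forall fun ω => ?_)
  rw [Real.norm_of_nonneg (Real.exp_nonneg _), Real.exp_le_exp]
  refine (le_abs_self _).trans ?_
  rw [abs_mul]
  exact mul_le_mul_of_nonneg_left (abs_slotSum_le (hK ()) t ω) (abs_nonneg η)

theorem integrable_lyapunov [IsFiniteMeasure μ]
    (network : IsSlottedNetwork μ ℱ p served success)
    (hyperplane : ∑ j, q j / p j = 1) (η : ℝ) (t : ℕ) :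
    Integrable (lyapunov p q served success η t) μ := by
  refine integrable_finsetSum _ fun j _ => ?_
  simpa only [excess_eq_slotSum hyperplane] using
    network.integrable_exp_mul_slotSum (excessStep p q j) η t

theorem condExp_exp_mul_slotSum_succ_le [IsFiniteMeasure μ]
    (network : IsSlottedNetwork μ ℱ p served success)
    {f : Fin N → ℝ → ℝ} (hD : ∀ t ω, |f (served t ω) (outcome success t ω)| ≤ D)
    (hηD : |η| * D ≤ 1) (t : ℕ) :
    μ[fun ω => Real.exp (η * slotSum served success f (t + 1) ω) | ℱ t] ≤ᵐ[μ]
      fun ω => Real.exp (η * slotSum served success f t ω) *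
        (1 + η * slotMean p f (served t ω) + η ^ 2 * D ^ 2) := by
  have hmeas : AEStronglyMeasurable (fun ω => f (served t ω) (outcome success t ω)) μ :=
    (network.integrable_reward f t).aestronglyMeasurable
  have hexp := condExp_exp_add_mul_le (ℱ.le t) hmeas (.of_forall (hD t)) hηD le_rfl
    ((network.stronglyAdapted_slotSum f t).const_mul η)
    (network.integrable_exp_mul_slotSum f η t)
  have hsucc (ω : Ω) : η * slotSum served success f (t + 1) ω =
      η * slotSum served success f t ω + η * f (served t ω) (outcome success t ω) := by
    rw [← mul_add, ← slotSum_succ_sub f t ω, add_sub_cancel]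
  simp only [hsucc]
  filter_upwards [hexp, network.condExp_reward f t,
    condExp_sq_le (ℱ.le t) hmeas (.of_forall (hD t))] with ω hexp hmean hsq
  refine hexp.trans (mul_le_mul_of_nonneg_left ?_ (Real.exp_nonneg _))
  rw [hmean, add_self_div_two, one_mul]
  gcongr

theorem condExp_lyapunov_succ_le [IsFiniteMeasure μ]
    (network : IsSlottedNetwork μ ℱ p served success)
    (mwdf : IsMWDF p q served success) (hp : ∀ j, p j ≠ 0) (hyperplane : ∑ j, q j / p j = 1)
    (hρ : 0 ≤ ρ) (hr : ∀ k, ρ ≤ q k / p k) (hη : 0 ≤ η)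
    (hD : ∀ j t ω, |excessStep p q j (served t ω) (outcome success t ω)| ≤ D)
    (hηD : η * D ≤ 1) (hηρ : η ^ 2 * D ^ 2 * (2 * N) = η * ρ) (t : ℕ) :
    μ[lyapunov p q served success η (t + 1) | ℱ t] ≤ᵐ[μ]
      fun ω => (1 - η ^ 2 * D ^ 2) * lyapunov p q served success η t ω +
        η ^ 2 * D ^ 2 * (2 * N) := by
  have hsum : lyapunov p q served success η (t + 1) =
      ∑ j, fun ω => Real.exp (η * slotSum served success (excessStep p q j) (t + 1) ω) := by
    funext ω
    simp only [lyapunov, excess_eq_slotSum hyperplane, Finset.sum_apply]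
  have hexp := ae_all_iff.2 fun j => network.condExp_exp_mul_slotSum_succ_le (hD j)
    (by rwa [abs_of_nonneg hη]) t
  rw [hsum]
  filter_upwards [hexp, condExp_finsetSum (s := Finset.univ) (fun j _ =>
    network.integrable_exp_mul_slotSum (excessStep p q j) η (t + 1)) (ℱ t)] with ω hexp hadd
  rw [hadd, Finset.sum_apply]
  refine (Finset.sum_le_sum fun j _ => hexp j).trans ?_
  simp only [slotMean_excessStep hp, ← excess_eq_slotSum hyperplane]
  exact mwdf.sum_exp_excess_mul_le hyperplane hρ hr hη hηρ t ω

theorem exists_integral_lyapunov_le [IsProbabilityMeasure μ]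
    (network : IsSlottedNetwork μ ℱ p served success)
    (mwdf : IsMWDF p q served success) (hp : ∀ j, 0 < p j) (hq : ∀ j, 0 < q j)
    (hyperplane : ∑ j, q j / p j = 1) :
    ∃ η > 0, ∀ t, ∫ ω, lyapunov p q served success η t ω ∂μ ≤ 2 * N := by
  have hr (k : Fin N) : 0 < q k / p k := div_pos (hq k) (hp k)
  have hN : (1 : ℝ) ≤ N := one_le_natCast_of_sum_eq_one hyperplane
  have hne : Nonempty (Fin N) := ⟨⟨0, Nat.one_le_cast.1 hN⟩⟩
  obtain ⟨i, hi⟩ := Finite.exists_min fun j => q j / p j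
  obtain ⟨C, hC⟩ := exists_forall_abs_reward_le (excessStep p q) served success
  have hD : 0 < max C (q i / p i) := (hr i).trans_le (le_max_right _ _)
  obtain ⟨η, hη, hηD, hηρ⟩ := exists_pos_mul_le_one_sq_mul_eq (by linarith : (0 : ℝ) < 2 * N)
    hD (hr i) ((le_max_right C _).trans (le_mul_of_one_le_left hD.le (by linarith)))
  refine ⟨η, hη, integral_le_of_condExp_drift_le (ℱ := ℱ) ?_
    (network.integrable_lyapunov hyperplane η) ?_
    (network.condExp_lyapunov_succ_le mwdf (fun j => (hp j).ne') hyperplane (hr i).le hi hη.le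
      (fun j t ω => (hC j t ω).trans (le_max_left _ _)) hηD hηρ)⟩
  · rw [← mul_pow]
    exact pow_le_one₀ (by positivity) hηD
  · have hzero : lyapunov p q served success η 0 = fun _ => (N : ℝ) := by
      funext ω
      simp [lyapunov, excess_eq_slotSum hyperplane, slotSum_zero]
    rw [hzero, integral_const, probReal_univ, one_smul]
    linarith

theorem ae_excess_isLittleO_phi [IsProbabilityMeasure μ]
    (network : IsSlottedNetwork μ ℱ p served success)
    (mwdf : IsMWDF p q served success) (hp : ∀ j, 0 < p j) (hq : ∀ j, 0 < q j)
    (hyperplane : ∑ j, q j / p j = 1) :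
    ∀ᵐ ω ∂μ, ∀ j, (fun t => excess p q served success j t ω) =o[atTop] phi := by
  obtain ⟨η, hη, hmean⟩ := network.exists_integral_lyapunov_le mwdf hp hq hyperplane
  filter_upwards [ae_eventually_lt_sq_of_integral_le
    (fun t => .of_forall fun ω => Finset.sum_nonneg fun j _ => Real.exp_nonneg _)
    (network.integrable_lyapunov hyperplane η) hmean] with ω hω j
  refine IsBigO.trans_isLittleO (.of_bound (N * (2 / η)) ?_) log_isLittleO_phi
  filter_upwards [hω, eventually_gt_atTop 0] with t ht htpos
  have hle (k : Fin N) : excess p q served success k t ω ≤ 2 / η * Real.log t := by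
    have hexp : Real.exp (η * excess p q served success k t ω) ≤ (t : ℝ) ^ 2 :=
      (Finset.single_le_sum (f := fun k => Real.exp (η * excess p q served success k t ω))
        (fun _ _ => Real.exp_nonneg _) (Finset.mem_univ k)).trans ht.le
    have hlog := (Real.le_log_iff_exp_le (by positivity)).2 hexp
    rw [Real.log_pow, Nat.cast_ofNat] at hlog
    rw [div_mul_eq_mul_div, le_div_iff₀' hη]
    exact hlog
  have habs := abs_le_card_mul_of_sum_eq_zero (sum_excess_eq_zero j.pos.ne' t ω) hle j
  rwa [Fintype.card_fin, ← mul_assoc, ← Real.norm_eq_abs, ← Real.norm_of_nonneg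
    (Real.log_natCast_nonneg t)] at habs

end IsSlottedNetwork

end Collapse

section Conclusion

variable {Ω : Type*} [mΩ : MeasurableSpace Ω] {μ : Measure Ω} [IsProbabilityMeasure μ]
  {ℱ : Filtration ℕ mΩ} {N : ℕ} {p q : Fin N → ℝ} {served : ℕ → Ω → Fin N}
  {success : ℕ → Set Ω}

namespace IsSlottedNetwork

theorem ae_attempts_sub_isLittleO (network : IsSlottedNetwork μ ℱ p served success)
    (mwdf : IsMWDF p q served success) (hp : ∀ j, 0 < p j) (hq : ∀ j, 0 < q j)
    (hyperplane : ∑ j, q j / p j = 1) :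
    ∀ᵐ ω ∂μ, ∀ j, (fun t : ℕ => attempts served j t ω - t * (q j / p j))
      =o[atTop] fun t : ℕ => (t : ℝ) := by
  filter_upwards [network.ae_excess_isLittleO_phi mwdf hp hq hyperplane,
    network.ae_slotSum_isLittleO (slotMean_one_sub_div fun j => (hp j).ne'),
    ae_all_iff.2 fun j => network.ae_slotSum_isLittleO (slotMean_ite_one_sub_div (hp j).ne')]
    with ω hexcess htotal hserved j
  have hdecomp (t : ℕ) : attempts served j t ω - t * (q j / p j) =
      slotSum served success (fun k b => if k = j then 1 - b / p j else 0) t ω -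
        excess p q served success j t ω -
        (N : ℝ)⁻¹ * slotSum served success (fun k b => 1 - b / p k) t ω := by
    have hdebt := debt_div_eq_sub_attempts_add (p := p) (q := q) (served := served)
      (success := success) j t ω
    rw [excess, totalDebt_eq_slotSum hyperplane, div_eq_inv_mul _ (N : ℝ), hdebt]
    ring
  simp only [hdecomp]
  exact ((hserved j).sub ((hexcess j).trans phi_isLittleO_natCast)).sub
    (htotal.const_mul_left _)

theorem ae_forall_eventually_sum_attempts_mul_le (network : IsSlottedNetwork μ ℱ p served success)
    (mwdf : IsMWDF p q served success) (hp : ∀ j, 0 < p j) (hq : ∀ j, 0 < q j)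
    (hyperplane : ∑ j, q j / p j = 1) :
    ∀ᵐ ω ∂μ, ∀ v > ∑ k, lilConst (p k) (q k), ∀ᶠ t : ℕ in atTop,
      ∑ j, attempts served j t ω * ((1 - p j) / p j) ≤ v * t := by
  filter_upwards [network.ae_attempts_sub_isLittleO mwdf hp hq hyperplane] with ω hω v hv
  have hfluctuation : (fun t : ℕ => ∑ j, (1 - p j) / p j *
      (attempts served j t ω - t * (q j / p j))) =o[atTop] fun t : ℕ => (t : ℝ) :=
    .fun_sum fun j _ => (hω j).const_mul_left _
  filter_upwards [hfluctuation.def (sub_pos.2 hv)] with t ht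
  have hmean : ∑ j, (1 - p j) / p j * (t * (q j / p j)) = t * ∑ k, lilConst (p k) (q k) := by
    rw [Finset.mul_sum]
    refine Finset.sum_congr rfl fun k _ => ?_
    rw [lilConst]
    field_simp
  rw [Real.norm_natCast] at ht
  have hle := (le_abs_self _).trans ht
  simp only [mul_sub, Finset.sum_sub_distrib, hmean] at hle
  simp only [mul_comm (attempts served _ t ω)]
  linarith

theorem ae_forall_eventually_totalDebt_le_mul_phi
    (network : IsSlottedNetwork μ ℱ p served success)
    (mwdf : IsMWDF p q served success) (hp : ∀ j, 0 < p j) (hq : ∀ j, 0 < q j)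
    (hyperplane : ∑ j, q j / p j = 1) :
    ∀ᵐ ω ∂μ, ∀ x > √(∑ k, lilConst (p k) (q k)), ∀ᶠ t in atTop,
      totalDebt p q served success t ω ≤ x * phi t := by
  have hp' (j : Fin N) : p j ≠ 0 := (hp j).ne'
  filter_upwards [network.ae_forall_eventually_sum_attempts_mul_le mwdf hp hq hyperplane,
    network.ae_forall_eventually_slotSum_le_mul_phi (slotMean_one_sub_div hp')]
    with ω hvariation hlil x hx
  obtain ⟨s, hs, hsx⟩ := exists_between hx
  have hs₀ : 0 ≤ s := (Real.sqrt_nonneg _).trans hs.le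
  simp only [totalDebt_eq_slotSum hyperplane]
  refine hlil s x hs₀ hsx ?_
  simpa only [slotMean_sq_one_sub_div hp'] using
    hvariation (s ^ 2) (Real.lt_sq_of_sqrt_lt hs)

end IsSlottedNetwork

end Conclusion

theorem lilConst_nonneg {p q : ℝ} (hp : p ≤ 1) (hq : 0 ≤ q) : 0 ≤ lilConst p q :=
  div_nonneg (mul_nonneg hq (sub_nonneg.2 hp)) (sq_nonneg p)

theorem mainTheorem4_general {Ω : Type*} [mΩ : MeasurableSpace Ω] {μ : Measure Ω}
    [IsProbabilityMeasure μ] {ℱ : Filtration ℕ mΩ} {N : ℕ} {p q : Fin N → ℝ}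
    (hp_pos : ∀ j, 0 < p j) (hq_pos : ∀ j, 0 < q j) (hyperplane : ∑ j, q j / p j = 1)
    {served : ℕ → Ω → Fin N} {success : ℕ → Set Ω}
    (network : IsSlottedNetwork μ ℱ p served success) (mwdf : IsMWDF p q served success) :
    ∀ᵐ ω ∂μ, ∀ j : Fin N,
      limsup (fun t : ℕ => ((debt q served success j t ω / phi t : ℝ) : EReal)) atTop ≤
        ((p j * (√(∑ k, lilConst (p k) (q k)) / N) : ℝ) : EReal) := by
  have hN : (0 : ℝ) < N := zero_lt_one.trans_le (one_le_natCast_of_sum_eq_one hyperplane)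
  filter_upwards [network.ae_excess_isLittleO_phi mwdf hp_pos hq_pos hyperplane,
    network.ae_forall_eventually_totalDebt_le_mul_phi mwdf hp_pos hq_pos hyperplane]
    with ω hexcess htotal j
  refine limsup_div_le_of_forall_gt eventually_phi_pos fun y hy => ?_
  have hy' : √(∑ k, lilConst (p k) (q k)) < y / p j * N := by
    rwa [← div_lt_iff₀ hN, lt_div_iff₀' (hp_pos j)]
  obtain ⟨x, hx, hxy⟩ := exists_between hy'
  have hgap : 0 < y / p j - x / N := sub_pos.2 ((div_lt_iff₀ hN).2 hxy)
  filter_upwards [(hexcess j).def hgap, htotal x hx] with t hexcess htotal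
  rw [Real.norm_of_nonneg (phi_nonneg t)] at hexcess
  calc debt q served success j t ω
      = p j * (excess p q served success j t ω + totalDebt p q served success t ω / N) :=
        debt_eq_mul_excess_add (hp_pos j).ne' t ω
    _ ≤ p j * ((y / p j - x / N) * phi t + x * phi t / N) := by
        gcongr
        exacts [(hp_pos j).le, (le_abs_self _).trans hexcess]
    _ = y * phi t := by
        have := (hp_pos j).ne'
        field_simp
        ring

theorem mainTheorem4 {Ω : Type*} [mΩ : MeasurableSpace Ω] (μ : Measure Ω)
    [IsProbabilityMeasure μ] (ℱ : Filtration ℕ mΩ) (N : ℕ) (p q : Fin N → ℝ)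
    (hp_pos : ∀ j, 0 < p j) (hp_le : ∀ j, p j ≤ 1) (hq_pos : ∀ j, 0 < q j)
    (hyperplane : ∑ j, q j / p j = 1)
    (served : ℕ → Ω → Fin N) (success : ℕ → Set Ω)
    (network : IsSlottedNetwork μ ℱ p served success)
    (mwdf : IsMWDF p q served success) :
    ∀ᵐ ω ∂μ, ∀ j : Fin N,
      limsup (fun t : ℕ => ((debt q served success j t ω / phi t : ℝ) : EReal)) atTop ≤
        ((p j * ((∑ k, Real.sqrt (lilConst (p k) (q k))) / (N : ℝ)) : ℝ) : EReal) := by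
  filter_upwards [mainTheorem4_general hp_pos hq_pos hyperplane network mwdf] with ω hω j
  refine (hω j).trans (EReal.coe_le_coe_iff.2 ?_)
  gcongr
  exacts [(hp_pos j).le, sqrt_sum_le_sum_sqrt fun k _ => lilConst_nonneg (hp_le k) (hq_pos k).le]
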